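/- **Embedding.** Let $G_E=(V_E,E_E)$ be a finite graph (parallel edges allowed) with $N_E=|V_E|$ vertices, in which every edge $e$ carries a dimension size $s_e\in\{1,2,\dots\}$ and is adjacent either to one vertex (uncontracted) or to two distinct vertices (contracted). Let $\bar E$ be a set of uncontracted edges (the input edges, connecting the embedding to the data), and let $E_1$ be the set of the other uncontracted edges (the output edges). Place at each vertex $v$ a random real tensor $\mathcal A_v$ with one index in $[s_e]$ for each edge $e$ adjacent to $v$. The tensor network embedding $\mathbf S$ is the random matrix obtained by multiplying all the tensors, summing over the indices of the contracted edges, and grouping the indices of the edges in $E_1$ into the row and those of the edges in $\bar E$ into the column. **Linearization.** A linearization is an ordering $v_1,\dots,v_{N_E}$ of the vertices. For a given linearization, $\mathbf A_i$ denotes the matricization of $\mathcal A_{v_i}$ in which the output dimensions and the contracted dimensions shared with some $v_j$, $j>i$, form the row, and the other dimensions (the input dimensions and the contracted dimensions shared with some $v_j$, $j<i$) form the column; let $m_i$ be the number of rows of $\mathbf A_i$. The embedding is Gaussian (with this linearization) if the tensors are independent and each $\mathbf A_i$ equals $m_i^{-1/2}$ times a matrix with independent $N(0,1)$ entries. **Theorem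 3.1.** For every $\delta_0\in(0,1)$ there is a constant $C>0$, depending only on $\delta_0$, such that the following holds for all $\varepsilon\in(0,1]$ and $\delta\in(0,\delta_0]$. If a Gaussian tensor network embedding $\mathbf S$ has a linearization for which $$m_i\;\ge\; C\,\frac{N_E\log(1/\delta)}{\varepsilon^2}\qquad\text{for every } i\in\{1,\dots,N_E\},$$ then $\mathbf S$ is $(\varepsilon,\delta)$-accurate: for every vector $x$ with $\|x\|_2=1$, $$\Pr\left(\left|\,\|\mathbf S x\|_2^2-1\right|>\varepsilon\right)<\delta .$$ -/

import Mathlib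

open MeasureTheory ProbabilityTheory
open scoped Matrix

universe u v w

noncomputable section

/-- The graph of a tensor network embedding, with vertex set `V` and edge set `E` (parallel edges
are allowed). Every edge represents one tensor dimension, of size `dim e ≥ 1` (the weight of `e` is
the logarithm of `dim e`). An edge is adjacent to one vertex (uncontracted) or to two distinct
vertices (contracted). The edges in `input` are the uncontracted edges that connect the embedding
to the data. -/
structure EmbeddingNetwork (V : Type u) (E : Type v) where
  ends : E → Finset V
  card_ends : ∀ e, (ends e).card = 1 ∨ (ends e).card = 2
  dim : E → ℕ
  dim_pos : ∀ e, 0 < dim e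
  input : Finset E
  input_uncontracted : ∀ e ∈ input, (ends e).card = 1

namespace EmbeddingNetwork

variable {V : Type u} {E : Type v} [Fintype V] [DecidableEq V] [Fintype E] [DecidableEq E]

/-- The uncontracted edges that are not connected to the data: the output sketch dimensions. -/
def output (G : EmbeddingNetwork V E) : Finset E :=
  Finset.univ.filter fun e => (G.ends e).card = 1 ∧ e ∉ G.input

/-- The edges adjacent to the vertex `a`. -/
def incident (G : EmbeddingNetwork V E) (a : V) : Finset E :=
  Finset.univ.filter fun e => a ∈ G.ends e

/-- Multi-indices: one index in `Fin (dim e)` for every edge `e` of the edge set `F`. -/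
abbrev Idx (G : EmbeddingNetwork V E) (F : Finset E) : Type v :=
  (e : F) → Fin (G.dim e)

/-- The space of tensors that can sit at the vertex `a`: one real entry for every multi-index over
the edges adjacent to `a`. -/
abbrev Core (G : EmbeddingNetwork V E) (a : V) : Type v :=
  G.Idx (G.incident a) → ℝ

/-- The embedding matrix: the tensor described by the network (sum, over all values of the
contracted dimensions, of the product of the tensors at the vertices), matricized with the output
dimensions as row index and the input dimensions as column index. The sum runs over all assignments
`x` of an index to every edge that take the prescribed values on the uncontracted edges. -/
def embedding (G : EmbeddingNetwork V E) (T : (a : V) → G.Core a) :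
    Matrix (G.Idx G.output) (G.Idx G.input) ℝ :=
  Matrix.of fun r c =>
    ∑ x : ((e : E) → Fin (G.dim e)),
      if (∀ e : G.output, x e = r e) ∧ (∀ e : G.input, x e = c e) then
        ∏ a : V, T a (fun e => x e)
      else 0

/-- A linearization orders the vertices of the embedding as `v₁, …, v_N` where `N` is the number of
vertices; contracted edges are then directed towards the vertex with the higher index. -/
abbrev Linearization (_G : EmbeddingNetwork V E) : Type u :=
  V ≃ Fin (Fintype.card V)

/-- The dimensions of the tensor at `a` that are grouped into the row of its matricization: the
output dimensions, and the contracted dimensions shared with a vertex of higher index. -/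
def rowEdges (G : EmbeddingNetwork V E) (σ : G.Linearization) (a : V) : Finset E :=
  (G.incident a).filter fun e => e ∈ G.output ∨ ∃ b ∈ G.ends e, σ a < σ b

/-- The remaining dimensions of the tensor at `a`: the input dimensions, and the contracted
dimensions shared with a vertex of lower index. -/
def colEdges (G : EmbeddingNetwork V E) (σ : G.Linearization) (a : V) : Finset E :=
  G.incident a \ G.rowEdges σ a

/-- The matricization of a tensor `t` at the vertex `a` in the linearization `σ`. -/
def coreMatrix (G : EmbeddingNetwork V E) (σ : G.Linearization) (a : V) (t : G.Core a) :
    Matrix (G.Idx (G.rowEdges σ a)) (G.Idx (G.colEdges σ a)) ℝ :=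
  Matrix.of fun r c => t fun e =>
    if h : (e : E) ∈ G.rowEdges σ a then r ⟨e, h⟩
    else c ⟨e, Finset.mem_sdiff.mpr ⟨e.2, h⟩⟩

/-- The row size of the matricized tensor at the vertex `a`: its number of rows. -/
def rowSize (G : EmbeddingNetwork V E) (σ : G.Linearization) (a : V) : ℕ :=
  Fintype.card (G.Idx (G.rowEdges σ a))

end EmbeddingNetwork

/-- A random matrix `S` with `m` rows is a Gaussian embedding if `S = M / √m` where the entries of
`M` are independent standard Gaussian random variables. -/
def IsGaussianEmbedding {Ω : Type w} [MeasurableSpace Ω] (P : Measure Ω)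
    {m n : Type v} [Fintype m] (S : Ω → Matrix m n ℝ) : Prop :=
  ∃ M : m × n → Ω → ℝ,
    (∀ k, HasLaw (M k) (gaussianReal 0 1) P) ∧ iIndepFun M P ∧
      ∀ ω i j, S ω i j = 1 / √(Fintype.card m : ℝ) * M (i, j) ω

/-- The random tensors `A` at the vertices are those of a Gaussian tensor network embedding, with
linearization `σ`: they are independent, and each of them, matricized according to `σ`, is a
Gaussian embedding. -/
def EmbeddingNetwork.IsGaussian {V : Type u} {E : Type v} [Fintype V] [DecidableEq V] [Fintype E]
    [DecidableEq E] {Ω : Type w} [MeasurableSpace Ω] (G : EmbeddingNetwork V E)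
    (σ : G.Linearization) (P : Measure Ω) (A : (a : V) → Ω → G.Core a) : Prop :=
  iIndepFun A P ∧ ∀ a, IsGaussianEmbedding P fun ω => G.coreMatrix σ a (A a ω)

/-- The `(ε, δ)`-accurate embedding property of a random matrix: for every vector `x` of Euclidean
norm one, `|‖S x‖² - 1| > ε` has probability less than `δ`. -/
def IsAccurateEmbedding {Ω : Type w} [MeasurableSpace Ω] (P : Measure Ω)
    {m n : Type v} [Fintype m] [Fintype n] (S : Ω → Matrix m n ℝ) (ε δ : ℝ) : Prop :=
  ∀ x : EuclideanSpace ℝ n, ‖x‖ = 1 →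
    P.real {ω | ε < |‖WithLp.toLp 2 (S ω *ᵥ x.ofLp)‖ ^ 2 - 1|} < δ

end

set_option linter.unusedSectionVars false

/-! The vertices are absorbed in the order of the linearization. Absorbing `v_i` multiplies the
current tensor, matricized as `X`, by the Gaussian matrix `A_i`; the dimensions not touched form the
column index of `X`. So every step is a Gaussian matrix with `m_i` rows, independent of the previous
ones, acting on a matrix.

Given `X`, the squared Frobenius norm after the step is `‖X‖²` times a weighted mean of variables
`χ²_m / m`, one per nonzero column of `X`. These may be dependent, but `y ↦ y ^ z` is convex on `(0,
∞)` for every integer `z`, so Jensen bounds the `z`-th moment of the mean by that of `χ²_m / m`,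
which is at most `exp (4 z² / m)` if `|z| ≤ m / 4` (`IsGaussianEmbedding.lintegral_rpow_le`). By
independence the bounds multiply (`lintegral_normSq_partialSketch_le`): the `z`-th moment of `‖S
x‖²` is at most `exp (4 z² ∑ 1 / m_i) ≤ exp (4 z² / B)` with `B = C log (1/δ) / ε²`, because `m_i ≥
N B`. Markov's inequality for `z = ±q`, with `q` of order `B ε`, controls both tails
(`measureReal_abs_sub_one_lt`).

To avoid tensors of changing shape, all intermediate tensors are functions on the assignments of all
edges. Their entries are then repeated; factors `rowSize / colSize` account for the multiplicities.
-/

/-! ### The chi-squared law and its integer moments -/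

theorem mgf_gammaMeasure {a r : ℝ} (ha : 0 < a) (hr : 0 < r) (t : ℝ) :
    mgf id (gammaMeasure a r) t = if t < r then (r / (r - t)) ^ a else 0 := by
  have hΓ : 0 < Real.Gamma a := Real.Gamma_pos_of_pos ha
  have h1 : mgf id (gammaMeasure a r) t
      = ∫ x in Set.Ioi (0 : ℝ), r ^ a / Real.Gamma a * (x ^ (a - 1) * Real.exp (-((r - t) * x))) := by
    rw [mgf, gammaMeasure, integral_withDensity_eq_integral_toReal_smul
      (by unfold gammaPDF; exact (measurable_gammaPDFReal a r).ennreal_ofReal)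
      (by simp [gammaPDF]), ← integral_Ici_eq_integral_Ioi,
      ← integral_indicator measurableSet_Ici]
    congr 1
    ext x
    by_cases hx : 0 ≤ x
    · rw [Set.indicator_of_mem (by exact hx), gammaPDF,
        ENNReal.toReal_ofReal (gammaPDFReal_nonneg ha hr x), gammaPDFReal, if_pos hx]
      simp only [id, smul_eq_mul]
      rw [mul_assoc, mul_assoc, ← Real.exp_add]
      ring_nf
    · rw [Set.indicator_of_notMem (by simpa using hx), gammaPDF, gammaPDFReal, if_neg hx]
      simp
  rw [h1]
  split_ifs with ht
  · have : 0 < r - t := by linarith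
    rw [integral_const_mul, Real.integral_rpow_mul_exp_neg_mul_Ioi ha this,
      Real.div_rpow hr.le this.le, Real.div_rpow zero_le_one this.le, Real.one_rpow]
    field_simp
  -- The value 0 is the convention for a divergent integral: here the exponential is at least 1, and
  -- no power is integrable on all of `(0, ∞)`.
  · refine integral_undef fun hint => not_integrableOn_Ioi_rpow (a - 1) ?_
    have h2 : IntegrableOn (fun x : ℝ => x ^ (a - 1) * Real.exp (-((r - t) * x))) (Set.Ioi 0) := by
      have := hint.const_mul (r ^ a / Real.Gamma a)⁻¹
      refine this.congr (Filter.Eventually.of_forall fun x => ?_)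
      have : 0 < r ^ a := Real.rpow_pos_of_pos hr _
      simp only
      field_simp
    refine Integrable.mono' h2 (by fun_prop) ?_
    refine (ae_restrict_iff' measurableSet_Ioi).mpr (Filter.Eventually.of_forall fun x hx => ?_)
    have hx' : (0 : ℝ) < x := hx
    rw [Real.norm_of_nonneg (by positivity)]
    refine le_mul_of_one_le_right (by positivity) (Real.one_le_exp ?_)
    nlinarith

theorem mgf_sq_gaussianReal (t : ℝ) :
    mgf (fun x => x ^ 2) (gaussianReal 0 1) t
      = if t < 1 / 2 then (1 / 2 / (1 / 2 - t)) ^ (1 / 2 : ℝ) else 0 := by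
  have h1 : mgf (fun x => x ^ 2) (gaussianReal 0 1) t
      = (√(2 * Real.pi))⁻¹ * √(Real.pi / (1 / 2 - t)) := by
    rw [mgf, integral_gaussianReal_eq_integral_smul one_ne_zero, ← integral_gaussian,
      ← integral_const_mul]
    congr 1
    ext x
    simp only [gaussianPDFReal, smul_eq_mul, NNReal.coe_one, mul_one, sub_zero]
    rw [mul_assoc, ← Real.exp_add]
    ring_nf
  rw [h1]
  split_ifs with ht
  · have : 0 < 1 / 2 - t := by linarith
    rw [← Real.sqrt_eq_rpow, ← Real.sqrt_inv, ← Real.sqrt_mul (by positivity)]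
    congr 1
    field_simp
  -- `integral_gaussian` covers the divergent case through the root of a nonpositive number, which
  -- is 0 by convention.
  · rw [Real.sqrt_eq_zero_of_nonpos (x := Real.pi / _), mul_zero]
    exact div_nonpos_of_nonneg_of_nonpos Real.pi_pos.le (by linarith)

/-- Analytic continuation from the real interval around 0 to a vertical strip carries the equality
to the imaginary axis, that is, to the characteristic functions. -/
theorem MeasureTheory.Measure.ext_of_mgf_eq {Ω Ω' : Type*} [MeasurableSpace Ω] [MeasurableSpace Ω']
    {μ : Measure Ω} {μ' : Measure Ω'} [IsProbabilityMeasure μ] [IsProbabilityMeasure μ']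
    {X : Ω → ℝ} {Y : Ω' → ℝ} (hX : AEMeasurable X μ) (hY : AEMeasurable Y μ')
    (h : mgf X μ = mgf Y μ') (h0 : 0 ∈ interior (integrableExpSet X μ)) :
    μ.map X = μ'.map Y := by
  have := Measure.isProbabilityMeasure_map hX
  have := Measure.isProbabilityMeasure_map hY
  refine Measure.ext_of_charFun ?_
  ext t
  rw [← complexMGF_mul_I hX, ← complexMGF_mul_I hY]
  exact eqOn_complexMGF_of_mgf h (by simpa using h0)

/-- The sum of the squares of `m` independent standard Gaussian variables is chi-squared
distributed with `m` degrees of freedom. -/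
theorem hasLaw_sum_sq_gaussian {Ω ι : Type*} [MeasurableSpace Ω] {P : Measure Ω} [Fintype ι]
    [Nonempty ι] {X : ι → Ω → ℝ} (hX : ∀ i, HasLaw (X i) (gaussianReal 0 1) P)
    (hind : iIndepFun X P) :
    HasLaw (fun ω => ∑ i, X i ω ^ 2) (gammaMeasure (Fintype.card ι / 2) (1 / 2)) P := by
  have hP := hind.isProbabilityMeasure
  have hm : (0 : ℝ) < Fintype.card ι := by exact_mod_cast Fintype.card_pos
  have hG := isProbabilityMeasure_gammaMeasure (a := Fintype.card ι / 2) (r := 1 / 2)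
    (by positivity) (by norm_num)
  have hXm : ∀ i, AEMeasurable (X i) P := fun i => (hX i).aemeasurable
  have hmeas : AEMeasurable (fun ω => ∑ i, X i ω ^ 2) P := by fun_prop
  have hmgf : ∀ t, mgf (fun ω => ∑ i, X i ω ^ 2) P t
      = if t < 1 / 2 then (1 / 2 / (1 / 2 - t)) ^ ((Fintype.card ι : ℝ) / 2) else 0 := by
    intro t
    have h1 : iIndepFun (fun i ω => X i ω ^ 2) P :=
      hind.comp (fun _ x => x ^ 2) (fun _ => by fun_prop)
    have h2 := h1.mgf_sum₀ (t := t) (fun i => by fun_prop) Finset.univ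
    have h3 : (∑ i, fun ω => X i ω ^ 2) = fun ω => ∑ i, X i ω ^ 2 := by ext; simp
    have h4 : ∀ i, mgf (fun ω => X i ω ^ 2) P t = mgf (fun x => x ^ 2) (gaussianReal 0 1) t := by
      intro i
      rw [mgf, mgf, ← (hX i).integral_comp (f := fun x => Real.exp (t * x ^ 2)) (by fun_prop)]
      rfl
    rw [← h3, h2, Finset.prod_congr rfl fun i _ => h4 i, Finset.prod_const, mgf_sq_gaussianReal,
      Finset.card_univ]
    split_ifs with ht
    · rw [← Real.rpow_natCast, ← Real.rpow_mul (div_nonneg (by norm_num) (by linarith))]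
      ring_nf
    · exact zero_pow Fintype.card_ne_zero
  refine ⟨hmeas, ?_⟩
  have key := Measure.ext_of_mgf_eq (μ' := gammaMeasure (Fintype.card ι / 2) (1 / 2)) hmeas
    aemeasurable_id ?_ ?_
  · rwa [Measure.map_id] at key
  · ext t
    rw [hmgf, mgf_gammaMeasure (by positivity) (by norm_num)]
  -- Where the exponential moment is not integrable the mgf is 0 by convention, whereas the formula
  -- is positive for all `t < 1 / 2`.
  · refine mem_interior.mpr ⟨Set.Iio (1 / 2), fun t ht => ?_, isOpen_Iio, by norm_num⟩
    by_contra hcon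
    have ht' : t < 1 / 2 := ht
    have h0 := mgf_undef hcon
    rw [hmgf, if_pos ht'] at h0
    exact (Real.rpow_pos_of_pos (div_pos (by norm_num) (by linarith)) _).ne' h0

theorem ae_pos_gammaMeasure (a r : ℝ) : ∀ᵐ x ∂gammaMeasure a r, 0 < x := by
  rw [gammaMeasure, ae_withDensity_iff
    (by unfold gammaPDF; exact (measurable_gammaPDFReal a r).ennreal_ofReal)]
  have : ∀ᵐ x : ℝ, x ≠ 0 := by simp [ae_iff]
  filter_upwards [this] with x hx h
  by_contra hx'
  exact h (gammaPDF_of_neg (lt_of_le_of_ne (not_lt.mp hx') hx))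

/-- Multiplying the density with shape `a` by `x ^ z` gives a multiple of the density with shape `a
+ z`. -/
theorem lintegral_zpow_gammaMeasure {a r : ℝ} (hr : 0 < r) (ha : 0 < a) {z : ℤ}
    (haz : 0 < a + z) :
    ∫⁻ x, ENNReal.ofReal (x ^ z) ∂gammaMeasure a r
      = ENNReal.ofReal (Real.Gamma (a + z) / Real.Gamma a / r ^ z) := by
  have hΓ : 0 < Real.Gamma a := Real.Gamma_pos_of_pos ha
  have hΓz : 0 < Real.Gamma (a + z) := Real.Gamma_pos_of_pos haz
  have hra := Real.rpow_pos_of_pos hr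
  set c : ℝ := Real.Gamma (a + z) / Real.Gamma a / r ^ z with hc
  have hc0 : 0 ≤ c := by positivity
  have hmeas : ∀ b, Measurable (gammaPDF b r) := fun b => by
    unfold gammaPDF; exact (measurable_gammaPDFReal b r).ennreal_ofReal
  rw [gammaMeasure, lintegral_withDensity_eq_lintegral_mul _ (hmeas a) (by fun_prop)]
  have : ∀ᵐ x : ℝ, (gammaPDF a r * fun x => ENNReal.ofReal (x ^ z)) x
      = ENNReal.ofReal c * gammaPDF (a + z) r x := by
    have : ∀ᵐ x : ℝ, x ≠ 0 := by simp [ae_iff]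
    filter_upwards [this] with x hx
    rcases lt_or_gt_of_ne hx with hx | hx
    · simp [gammaPDF_of_neg hx]
    · simp only [Pi.mul_apply, gammaPDF]
      rw [← ENNReal.ofReal_mul (gammaPDFReal_nonneg ha hr x), ← ENNReal.ofReal_mul hc0]
      congr 1
      rw [gammaPDFReal, gammaPDFReal, if_pos hx.le, if_pos hx.le, hc]
      have h1 : x ^ (a + z - 1) = x ^ (a - 1) * x ^ z := by
        rw [← Real.rpow_intCast x z, ← Real.rpow_add hx]; ring_nf
      have h2 : r ^ (a + z) = r ^ a * r ^ z := by
        rw [← Real.rpow_intCast r z, ← Real.rpow_add hr]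
      rw [h1, h2]
      field_simp
  rw [lintegral_congr_ae this, lintegral_const_mul _ (hmeas _), lintegral_gammaPDF_eq_one haz hr,
    mul_one]

/-- The left side is the product of `1 + j / a` over `j < q`, and each factor is at most `exp (j /
a)`. -/
theorem Gamma_add_natCast_le {a : ℝ} (ha : 0 < a) (q : ℕ) :
    Real.Gamma (a + q) / Real.Gamma a / a ^ q ≤ Real.exp (q ^ 2 / a) := by
  induction q with
  | zero => simp [(Real.Gamma_pos_of_pos ha).ne']
  | succ q ih =>
    have hΓ := Real.Gamma_pos_of_pos ha
    have hq : (0 : ℝ) < a + q := by positivity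
    have h1 : Real.Gamma (a + (q + 1 : ℕ)) = (a + q) * Real.Gamma (a + q) := by
      rw [← Real.Gamma_add_one hq.ne']; push_cast; ring_nf
    have h2 : Real.Gamma (a + (q + 1 : ℕ)) / Real.Gamma a / a ^ (q + 1)
        = (Real.Gamma (a + q) / Real.Gamma a / a ^ q) * (q / a + 1) := by
      rw [h1]; field_simp; ring
    rw [h2]
    calc _ ≤ Real.exp (q ^ 2 / a) * Real.exp (q / a) :=
          mul_le_mul ih (Real.add_one_le_exp _) (by positivity) (Real.exp_nonneg _)
      _ ≤ _ := by
          rw [← Real.exp_add, ← add_div]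
          gcongr
          push_cast
          nlinarith [Nat.cast_nonneg (α := ℝ) q]

/-- The left side is the product of `a / (a - j)` over `1 ≤ j ≤ q`; since `j ≤ a / 2`, each factor
is at most `1 + 2 j / a`. -/
theorem Gamma_sub_natCast_le {a : ℝ} (ha : 0 < a) (q : ℕ) (hq : q ≤ a / 2) :
    Real.Gamma (a - q) / Real.Gamma a * a ^ q ≤ Real.exp (2 * q ^ 2 / a) := by
  induction q with
  | zero => simp [(Real.Gamma_pos_of_pos ha).ne']
  | succ q ih =>
    push_cast at hq
    specialize ih (by linarith)
    have hΓ := Real.Gamma_pos_of_pos ha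
    set b : ℝ := a - (q + 1) with hb
    have hb0 : 0 < b := by linarith
    have hΓb := Real.Gamma_pos_of_pos hb0
    have h1 : Real.Gamma (a - q) = b * Real.Gamma b := by
      rw [← Real.Gamma_add_one hb0.ne', hb]; ring_nf
    rw [h1] at ih
    have h3 : a / b ≤ Real.exp (2 * (q + 1) / a) := by
      refine le_trans ?_ (Real.add_one_le_exp _)
      rw [div_add_one ha.ne', div_le_div_iff₀ hb0 ha]
      nlinarith [Nat.cast_nonneg (α := ℝ) q]
    have h2 : Real.Gamma (a - (q + 1 : ℕ)) / Real.Gamma a * a ^ (q + 1)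
        = (b * Real.Gamma b / Real.Gamma a * a ^ q) * (a / b) := by
      push_cast; rw [← hb, pow_succ]; field_simp
    rw [h2]
    calc _ ≤ Real.exp (2 * q ^ 2 / a) * Real.exp (2 * (q + 1) / a) :=
          mul_le_mul ih h3 (by positivity) (Real.exp_nonneg _)
      _ ≤ _ := by
          rw [← Real.exp_add, ← add_div]
          gcongr
          push_cast
          nlinarith [Nat.cast_nonneg (α := ℝ) q]

/-- The moments of the chi-squared distribution with `m` degrees of freedom, divided by `m`. -/
theorem lintegral_zpow_chiSq_le {m : ℕ} (hm : 0 < m) {z : ℤ} (hz : |(z : ℝ)| ≤ m / 4) :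
    ∫⁻ x, ENNReal.ofReal ((1 / (m : ℝ) * x) ^ z) ∂gammaMeasure (m / 2) (1 / 2)
      ≤ ENNReal.ofReal (Real.exp (4 * z ^ 2 / m)) := by
  have hm' : (0 : ℝ) < m := by exact_mod_cast hm
  have haz : (0 : ℝ) < m / 2 + z := by linarith [(abs_le.mp hz).1]
  have h1 : ∀ x : ℝ, ENNReal.ofReal ((1 / (m : ℝ) * x) ^ z)
      = ENNReal.ofReal ((1 / (m : ℝ)) ^ z) * ENNReal.ofReal (x ^ z) := by
    intro x
    rw [mul_zpow, ENNReal.ofReal_mul (by positivity)]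
  simp_rw [h1]
  rw [lintegral_const_mul _ (by fun_prop),
    lintegral_zpow_gammaMeasure (by norm_num) (by positivity) haz,
    ← ENNReal.ofReal_mul (by positivity)]
  refine ENNReal.ofReal_le_ofReal ?_
  have h2 : (1 / (m : ℝ)) ^ z * (Real.Gamma (m / 2 + z) / Real.Gamma (m / 2) / (1 / 2) ^ z)
      = Real.Gamma (m / 2 + z) / Real.Gamma (m / 2) / (m / 2 : ℝ) ^ z := by
    rw [div_zpow, div_zpow, div_zpow, one_zpow]
    field_simp
  rw [h2]
  -- With `a = m / 2`, positive powers would allow `2 z² / m`; the negative ones set the constant 4.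
  rcases Int.eq_nat_or_neg z with ⟨q, rfl | rfl⟩
  · push_cast
    rw [zpow_natCast]
    refine (Gamma_add_natCast_le (by positivity) q).trans (Real.exp_le_exp.mpr ?_)
    rw [div_le_div_iff₀ (by positivity) hm']
    nlinarith [mul_nonneg (sq_nonneg (q : ℝ)) hm'.le]
  · have hq : (q : ℝ) ≤ m / 2 / 2 := by
      have := hz
      push_cast at this
      rw [abs_neg, Nat.abs_cast] at this
      linarith
    have := Gamma_sub_natCast_le (a := m / 2) (by positivity) q hq
    push_cast
    rw [zpow_neg, zpow_natCast, div_inv_eq_mul, ← sub_eq_add_neg]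
    refine this.trans (Real.exp_le_exp.mpr (le_of_eq ?_))
    field_simp
    ring

/-! ### One multiplication by a Gaussian matrix -/

/-- A standard Gaussian matrix maps a unit vector to a standard Gaussian vector. -/
theorem gaussian_mulVec {Ω m n : Type*} [MeasurableSpace Ω] {P : Measure Ω} [Fintype m]
    [Fintype n] {M : m × n → Ω → ℝ} (hM : ∀ k, HasLaw (M k) (gaussianReal 0 1) P)
    (hind : iIndepFun M P) (v : n → ℝ) (hv : ∑ c, v c ^ 2 = 1) :
    (∀ r, HasLaw (fun ω => ∑ c, v c * M (r, c) ω) (gaussianReal 0 1) P) ∧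
      iIndepFun (fun r ω => ∑ c, v c * M (r, c) ω) P := by
  classical
  have hP := hind.isProbabilityMeasure
  have hG : ∀ k, HasGaussianLaw (M k) P := fun k => (hM k).hasGaussianLaw
  have hL2 : ∀ k, MemLp (M k) 2 P := fun k => (hG k).memLp_two
  -- A linear image of a Gaussian vector is Gaussian, so the covariances decide both the
  -- independence of the coordinates and their variance.
  let L : (m × n → ℝ) →L[ℝ] (m → ℝ) :=
    ContinuousLinearMap.pi fun r => ∑ c, v c • ContinuousLinearMap.proj (r, c)
  have hL : HasGaussianLaw (fun ω r => ∑ c, v c * M (r, c) ω) P := by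
    have h : (fun ω r => ∑ c, v c * M (r, c) ω) = fun ω => L fun k => M k ω := by
      ext ω r
      simp [L]
    rw [h]
    exact (iIndepFun.hasGaussianLaw hG hind).map_fun L
  have hcov : ∀ r r', cov[fun ω => ∑ c, v c * M (r, c) ω, fun ω => ∑ c, v c * M (r', c) ω; P]
      = if r = r' then 1 else 0 := by
    intro r r'
    rw [covariance_fun_sum_fun_sum (fun c => (hL2 _).const_mul _) (fun c => (hL2 _).const_mul _)]
    have h1 : ∀ c c', cov[fun ω => v c * M (r, c) ω, fun ω => v c' * M (r', c') ω; P]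
        = if r = r' ∧ c = c' then v c ^ 2 else 0 := by
      intro c c'
      rw [covariance_const_mul_left, covariance_const_mul_right]
      split_ifs with h
      · obtain ⟨rfl, rfl⟩ := h
        rw [covariance_self (hM _).aemeasurable, (hM _).variance_eq, variance_id_gaussianReal]
        simp [sq]
      · rw [(hind.indepFun (by simpa using h)).covariance_eq_zero (hL2 _) (hL2 _)]
        simp
    simp_rw [h1]
    by_cases h : r = r'
    · simp [h, hv]
    · simp [h]
  refine ⟨fun r => ?_, hL.iIndepFun_of_covariance_eq_zero fun i j hij => by rw [hcov, if_neg hij]⟩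
  have hr := (hL.eval r)
  refine ⟨hr.aemeasurable, ?_⟩
  rw [hr.map_eq_gaussianReal, ← covariance_self hr.aemeasurable, hcov, if_pos rfl,
    integral_finsetSum _ fun c _ => ((hL2 _).const_mul _).integrable (by norm_num)]
  have h0 : ∀ k, ∫ ω, M k ω ∂P = 0 := fun k => by
    rw [(hM k).integral_eq, integral_id_gaussianReal]
  simp [integral_const_mul, h0]

/-- Jensen's inequality for integer powers of a weighted mean of positive numbers. -/
theorem zpow_sum_mul_le {κ : Type*} (s : Finset κ) (w y : κ → ℝ) (hw : ∀ k ∈ s, 0 ≤ w k)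
    (hw1 : ∑ k ∈ s, w k = 1) (hy : ∀ k ∈ s, 0 < y k) (z : ℤ) :
    (∑ k ∈ s, w k * y k) ^ z ≤ ∑ k ∈ s, w k * y k ^ z :=
  (convexOn_zpow (𝕜 := ℝ) z).map_sum_le hw hw1 hy

/-- One sketching step: the `z`-th moment of the squared Frobenius norm grows by a factor of at
most `exp (4 z² / m)` under multiplication by a Gaussian embedding with `m` rows. -/
theorem IsGaussianEmbedding.lintegral_rpow_le {Ω : Type*} {m n : Type v} {κ : Type*}
    [MeasurableSpace Ω] {P : Measure Ω} [Fintype m] [Fintype n] [Fintype κ] [Nonempty m]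
    {S : Ω → Matrix m n ℝ} (hS : IsGaussianEmbedding P S) {z : ℤ} (hz0 : z ≠ 0)
    (hz : |(z : ℝ)| ≤ Fintype.card m / 4) (X : n → κ → ℝ) :
    ∫⁻ ω, ENNReal.ofReal (∑ r, ∑ k, (∑ c, S ω r c * X c k) ^ 2) ^ (z : ℝ) ∂P
      ≤ ENNReal.ofReal (Real.exp (4 * z ^ 2 / Fintype.card m))
        * ENNReal.ofReal (∑ c, ∑ k, X c k ^ 2) ^ (z : ℝ) := by
  classical
  obtain ⟨M, hM, hind, hSM⟩ := hS
  have hm : (0 : ℝ) < Fintype.card m := by exact_mod_cast Fintype.card_pos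
  have hP := hind.isProbabilityMeasure
  set K := ENNReal.ofReal (Real.exp (4 * z ^ 2 / Fintype.card m)) with hK
  have hK0 : K ≠ 0 := by simp [hK, Real.exp_pos]
  set D := ∑ c, ∑ k, X c k ^ 2 with hD
  set d : κ → ℝ := fun k => ∑ c, X c k ^ 2 with hd
  have hd0 : ∀ k, 0 ≤ d k := fun k => Finset.sum_nonneg fun c _ => sq_nonneg _
  have hDd : D = ∑ k, d k := Finset.sum_comm
  rcases (Finset.sum_nonneg fun k _ => hd0 k : 0 ≤ ∑ k, d k).eq_or_lt with h0 | h0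
  · have hX : ∀ c k, X c k = 0 := by
      intro c k
      have h1 := (Finset.sum_eq_zero_iff_of_nonneg fun k _ => hd0 k).mp h0.symm k (Finset.mem_univ k)
      have h2 := (Finset.sum_eq_zero_iff_of_nonneg fun c _ => sq_nonneg _).mp h1 c
        (Finset.mem_univ c)
      exact pow_eq_zero_iff two_ne_zero |>.mp h2
    rw [hDd, ← h0]
    -- For `X = 0` the right side is `⊤` if `z < 0`, and both sides vanish if `z > 0`.
    rcases lt_or_gt_of_ne hz0 with hz0 | hz0
    · have : (z : ℝ) < 0 := by exact_mod_cast hz0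
      rw [ENNReal.ofReal_zero, ENNReal.zero_rpow_of_neg this, ENNReal.mul_top hK0]
      exact le_top
    · have : (0 : ℝ) < z := by exact_mod_cast hz0
      simp [hX, ENNReal.zero_rpow_of_pos this]
  rw [← hDd] at h0
  -- Zero columns are dropped: they cannot be normalized, and Jensen for negative powers needs
  -- positive terms.
  set s : Finset κ := Finset.univ.filter fun k => 0 < d k with hs
  have hsd : ∀ k ∈ s, 0 < d k := fun k hk => (Finset.mem_filter.mp hk).2
  have hns : ∀ k ∉ s, ∀ c, X c k = 0 := by
    intro k hk c
    have h1 : d k = 0 := le_antisymm (by simpa [hs] using hk) (hd0 k)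
    have h2 := (Finset.sum_eq_zero_iff_of_nonneg fun c _ => sq_nonneg _).mp h1 c
      (Finset.mem_univ c)
    exact pow_eq_zero_iff two_ne_zero |>.mp h2
  have hDs : D = ∑ k ∈ s, d k := by
    rw [hDd]
    refine (Finset.sum_subset (Finset.subset_univ s) fun k _ hk => ?_).symm
    simp [hd, hns k hk]
  set Z : κ → Ω → ℝ := fun k ω => ∑ r, (∑ c, X c k / √(d k) * M (r, c) ω) ^ 2 with hZ
  have hlaw : ∀ k ∈ s, HasLaw (Z k) (gammaMeasure (Fintype.card m / 2) (1 / 2)) P := by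
    intro k hk
    have hunit : ∑ c, (X c k / √(d k)) ^ 2 = 1 := by
      simp_rw [div_pow, Real.sq_sqrt (hd0 k)]
      rw [← Finset.sum_div]
      exact div_self (hsd k hk).ne'
    obtain ⟨h1, h2⟩ := gaussian_mulVec hM hind _ hunit
    exact hasLaw_sum_sq_gaussian h1 h2
  have hpos : ∀ᵐ ω ∂P, ∀ k ∈ s, 0 < Z k ω := by
    refine (Finset.eventually_all s).mpr fun k hk => ?_
    exact ((hlaw k hk).ae_iff (by fun_prop)).mpr (ae_pos_gammaMeasure _ _)
  have hsum : ∀ ω, ∑ r, ∑ k, (∑ c, S ω r c * X c k) ^ 2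
      = D * ∑ k ∈ s, d k / D * (1 / (Fintype.card m : ℝ) * Z k ω) := by
    intro ω
    rw [Finset.sum_comm, Finset.mul_sum,
      ← Finset.sum_subset (Finset.subset_univ s) fun k _ hk => by simp [hns k hk]]
    refine Finset.sum_congr rfl fun k hk => ?_
    have hk' := hsd k hk
    rw [hZ, Finset.mul_sum, Finset.mul_sum, Finset.mul_sum]
    refine Finset.sum_congr rfl fun r _ => ?_
    have h1 : ∑ c, S ω r c * X c k
        = 1 / √(Fintype.card m : ℝ) * (√(d k) * ∑ c, X c k / √(d k) * M (r, c) ω) := by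
      rw [Finset.mul_sum, Finset.mul_sum]
      refine Finset.sum_congr rfl fun c _ => ?_
      rw [hSM]
      have : √(d k) ≠ 0 := (Real.sqrt_pos.mpr hk').ne'
      field_simp
    rw [h1, mul_pow, mul_pow, div_pow, Real.sq_sqrt hm.le, Real.sq_sqrt hk'.le]
    field_simp
  -- Jensen with weights `d k / D`. It leaves only moments of single `Z k`, so their joint law plays
  -- no role.
  have hbound : ∀ᵐ ω ∂P, ENNReal.ofReal (∑ r, ∑ k, (∑ c, S ω r c * X c k) ^ 2) ^ (z : ℝ)
      ≤ ENNReal.ofReal (D ^ z) * ∑ k ∈ s, ENNReal.ofReal (d k / D) *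
          ENNReal.ofReal ((1 / (Fintype.card m : ℝ) * Z k ω) ^ z) := by
    filter_upwards [hpos] with ω hω
    have hy : ∀ k ∈ s, 0 < 1 / (Fintype.card m : ℝ) * Z k ω := fun k hk =>
      mul_pos (by positivity) (hω k hk)
    have hw1 : ∑ k ∈ s, d k / D = 1 := by
      rw [← Finset.sum_div, ← hDs, div_self h0.ne']
    have hne : s.Nonempty := by
      by_contra hcon
      rw [Finset.not_nonempty_iff_eq_empty] at hcon
      simp [hcon] at hw1
    have hYpos : 0 < D * ∑ k ∈ s, d k / D * (1 / (Fintype.card m : ℝ) * Z k ω) :=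
      mul_pos h0 (Finset.sum_pos (fun k hk => mul_pos (div_pos (hsd k hk) h0) (hy k hk)) hne)
    rw [hsum, ENNReal.ofReal_rpow_of_pos hYpos, Real.rpow_intCast, mul_zpow,
      ENNReal.ofReal_mul (by positivity)]
    gcongr
    refine (ENNReal.ofReal_le_ofReal (zpow_sum_mul_le s _ _
      (fun k _ => div_nonneg (hd0 k) h0.le) hw1 hy z)).trans (le_of_eq ?_)
    rw [ENNReal.ofReal_sum_of_nonneg fun k hk =>
      mul_nonneg (div_nonneg (hd0 k) h0.le) (zpow_pos (hy k hk) z).le]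
    exact Finset.sum_congr rfl fun k _ => ENNReal.ofReal_mul (div_nonneg (hd0 k) h0.le)
  have hZm : ∀ k, AEMeasurable (Z k) P := fun k => by
    have hMm : ∀ k, AEMeasurable (M k) P := fun k => (hM k).aemeasurable
    fun_prop
  have hmoment : ∀ k ∈ s,
      ∫⁻ ω, ENNReal.ofReal ((1 / (Fintype.card m : ℝ) * Z k ω) ^ z) ∂P ≤ K := by
    intro k hk
    rw [(hlaw k hk).lintegral_comp
      (f := fun x => ENNReal.ofReal ((1 / (Fintype.card m : ℝ) * x) ^ z)) (by fun_prop)]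
    exact lintegral_zpow_chiSq_le Fintype.card_pos hz
  have hm' : ∀ k, AEMeasurable
      (fun ω => ENNReal.ofReal ((1 / (Fintype.card m : ℝ) * Z k ω) ^ z)) P := fun k => by
    have := hZm k
    have h2 : Measurable fun x : ℝ => ENNReal.ofReal ((1 / (Fintype.card m : ℝ) * x) ^ z) := by
      fun_prop
    exact h2.comp_aemeasurable this
  calc _ ≤ _ := lintegral_mono_ae hbound
    _ = ENNReal.ofReal (D ^ z) * ∑ k ∈ s, ENNReal.ofReal (d k / D) *
          ∫⁻ ω, ENNReal.ofReal ((1 / (Fintype.card m : ℝ) * Z k ω) ^ z) ∂P := by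
        rw [lintegral_const_mul'' _ (Finset.aemeasurable_fun_sum _ fun k _ => (hm' k).const_mul _),
          lintegral_finsetSum' _ fun k _ => (hm' k).const_mul _]
        congr 1
        exact Finset.sum_congr rfl fun k _ => lintegral_const_mul'' _ (hm' k)
    _ ≤ ENNReal.ofReal (D ^ z) * ∑ k ∈ s, ENNReal.ofReal (d k / D) * K := by
        gcongr with k hk
        exact hmoment k hk
    _ = K * ENNReal.ofReal D ^ (z : ℝ) := by
        rw [← Finset.sum_mul, ← ENNReal.ofReal_sum_of_nonneg fun k _ => div_nonneg (hd0 k) h0.le,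
          ← Finset.sum_div, ← hDs, div_self h0.ne', ENNReal.ofReal_one, one_mul, mul_comm,
          ENNReal.ofReal_rpow_of_pos h0, Real.rpow_intCast]

/-! ### Row and column edges of a linearization -/

namespace EmbeddingNetwork

variable {V : Type u} {E : Type v} [Fintype V] [DecidableEq V] [Fintype E] [DecidableEq E]

/-- Assignments of an index to every edge. -/
abbrev Assignment (G : EmbeddingNetwork V E) : Type v := (e : E) → Fin (G.dim e)

/-- The assignment that takes the values `c` on `F` and the values of `x` elsewhere. -/
def glue (G : EmbeddingNetwork V E) (F : Finset E) (c : G.Idx F) (x : G.Assignment) :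
    G.Assignment :=
  fun e => if h : e ∈ F then c ⟨e, h⟩ else x e

section Edges

variable (G : EmbeddingNetwork V E) (σ : G.Linearization)

theorem mem_incident {a : V} {e : E} : e ∈ G.incident a ↔ a ∈ G.ends e := by
  simp [incident]

theorem mem_output {e : E} : e ∈ G.output ↔ (G.ends e).card = 1 ∧ e ∉ G.input := by
  simp [output]

theorem mem_rowEdges {a : V} {e : E} : e ∈ G.rowEdges σ a ↔
    a ∈ G.ends e ∧ (e ∈ G.output ∨ ∃ b ∈ G.ends e, σ a < σ b) := by
  simp [rowEdges, mem_incident]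

theorem mem_colEdges {a : V} {e : E} : e ∈ G.colEdges σ a ↔
    a ∈ G.ends e ∧ e ∉ G.output ∧ ∀ b ∈ G.ends e, σ b ≤ σ a := by
  rw [colEdges, Finset.mem_sdiff, mem_rowEdges, mem_incident]
  push Not
  tauto

theorem notMem_incident_of_mem_colEdges {a b : V} (hab : σ b < σ a) {e : E}
    (he : e ∈ G.colEdges σ b) : e ∉ G.incident a := fun h =>
  absurd (((G.mem_colEdges σ).mp he).2.2 a (G.mem_incident.mp h)) (not_le.mpr hab)

theorem eq_of_card_ends {e : E} (h : (G.ends e).card = 1) {a b : V} (ha : a ∈ G.ends e)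
    (hb : b ∈ G.ends e) : a = b :=
  Finset.card_le_one.mp h.le a ha b hb

/-- A row edge of `a` is either an output edge, whose only end is `a`, or has ends `a` and some `d`
above `a`, which leaves no room for `b`. -/
theorem notMem_incident_of_mem_rowEdges {a b : V} (hab : σ b < σ a) {e : E}
    (he : e ∈ G.rowEdges σ a) : e ∉ G.incident b := by
  intro hb
  rw [mem_incident] at hb
  obtain ⟨ha, ho | ⟨d, hd, had⟩⟩ := (G.mem_rowEdges σ).mp he
  · have := G.eq_of_card_ends (G.mem_output.mp ho).1 ha hb
    exact hab.ne (by rw [this])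
  · have h3 : ({a, b, d} : Finset V).card = 3 := by
      refine Finset.card_eq_three.mpr ⟨a, b, d, ?_, ?_, ?_, rfl⟩
      · rintro rfl; exact hab.false
      · rintro rfl; exact had.false
      · rintro rfl; exact (hab.trans had).false
    have h4 : ({a, b, d} : Finset V) ⊆ G.ends e := by
      intro x hx
      simp only [Finset.mem_insert, Finset.mem_singleton] at hx
      rcases hx with rfl | rfl | rfl <;> assumption
    have := Finset.card_le_card h4
    rcases G.card_ends e with h | h <;> omega

theorem notMem_input_of_mem_rowEdges {a : V} {e : E} (he : e ∈ G.rowEdges σ a) :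
    e ∉ G.input := by
  intro hi
  obtain ⟨ha, ho | ⟨d, hd, had⟩⟩ := (G.mem_rowEdges σ).mp he
  · exact (G.mem_output.mp ho).2 hi
  · rw [G.eq_of_card_ends (G.input_uncontracted e hi) ha hd] at had
    exact had.false

theorem ends_nonempty (e : E) : (G.ends e).Nonempty := by
  rw [← Finset.card_pos]
  rcases G.card_ends e with h | h <;> omega

theorem exists_mem_colEdges {e : E} (he : e ∉ G.output) : ∃ a, e ∈ G.colEdges σ a := by
  obtain ⟨a, ha, hmax⟩ := Finset.exists_max_image (G.ends e) σ (G.ends_nonempty e)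
  exact ⟨a, (G.mem_colEdges σ).mpr ⟨ha, he, hmax⟩⟩

theorem exists_mem_rowEdges {e : E} (he : e ∉ G.input) : ∃ a, e ∈ G.rowEdges σ a := by
  obtain ⟨a, ha, hmin⟩ := Finset.exists_min_image (G.ends e) σ (G.ends_nonempty e)
  refine ⟨a, (G.mem_rowEdges σ).mpr ⟨ha, ?_⟩⟩
  rcases G.card_ends e with h | h
  · exact Or.inl (G.mem_output.mpr ⟨h, he⟩)
  · obtain ⟨b, hb, hba⟩ := Finset.exists_mem_ne (by omega : 1 < (G.ends e).card) a
    exact Or.inr ⟨b, hb, lt_of_le_of_ne (hmin b hb) fun h => hba (σ.injective h).symm⟩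

/-- A non-output edge is a column edge exactly at its highest end, and a non-input edge is a row
edge exactly at its lowest end. -/
theorem biUnion_colEdges : Finset.univ.biUnion (G.colEdges σ) = G.outputᶜ := by
  ext e
  simp only [Finset.mem_biUnion, Finset.mem_univ, true_and, Finset.mem_compl]
  exact ⟨fun ⟨a, ha⟩ => ((G.mem_colEdges σ).mp ha).2.1, G.exists_mem_colEdges σ⟩

theorem biUnion_rowEdges : Finset.univ.biUnion (G.rowEdges σ) = G.inputᶜ := by
  ext e
  simp only [Finset.mem_biUnion, Finset.mem_univ, true_and, Finset.mem_compl]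
  exact ⟨fun ⟨a, ha⟩ => G.notMem_input_of_mem_rowEdges σ ha, G.exists_mem_rowEdges σ⟩

theorem disjoint_colEdges {a b : V} (hab : a ≠ b) :
    Disjoint (G.colEdges σ a) (G.colEdges σ b) := by
  rw [Finset.disjoint_left]
  intro e ha hb
  rcases lt_or_gt_of_ne (σ.injective.ne hab) with h | h
  · exact G.notMem_incident_of_mem_colEdges σ h ha (Finset.sdiff_subset hb)
  · exact G.notMem_incident_of_mem_colEdges σ h hb (Finset.sdiff_subset ha)

theorem disjoint_rowEdges {a b : V} (hab : a ≠ b) :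
    Disjoint (G.rowEdges σ a) (G.rowEdges σ b) := by
  rw [Finset.disjoint_left]
  intro e ha hb
  rcases lt_or_gt_of_ne (σ.injective.ne hab) with h | h
  · exact G.notMem_incident_of_mem_rowEdges σ h hb (Finset.filter_subset _ _ ha)
  · exact G.notMem_incident_of_mem_rowEdges σ h ha (Finset.filter_subset _ _ hb)

theorem card_idx (F : Finset E) : Fintype.card (G.Idx F) = ∏ e ∈ F, G.dim e := by
  simp only [Fintype.card_pi, Fintype.card_fin]
  exact Finset.prod_coe_sort F G.dim

theorem card_idx_pos (F : Finset E) : 0 < Fintype.card (G.Idx F) := by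
  rw [card_idx]
  exact Finset.prod_pos fun e _ => G.dim_pos e

instance (F : Finset E) : Nonempty (G.Idx F) := Fintype.card_pos_iff.mp (G.card_idx_pos F)

/-- The number of columns of the matricized tensor at a vertex. -/
def colSize (a : V) : ℕ := Fintype.card (G.Idx (G.colEdges σ a))

theorem colSize_pos (a : V) : 0 < G.colSize σ a := G.card_idx_pos _

/-- Together with `card_output_mul_prod_colSize`, this evaluates the product of all factors `rowSize
/ colSize`. -/
theorem card_input_mul_prod_rowSize :
    Fintype.card (G.Idx G.input) * ∏ a, G.rowSize σ a = Fintype.card G.Assignment := by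
  simp only [rowSize, card_idx]
  rw [← Finset.prod_biUnion fun a _ b _ hab => G.disjoint_rowEdges σ hab, biUnion_rowEdges,
    Finset.prod_mul_prod_compl, Fintype.card_pi]
  simp

theorem card_output_mul_prod_colSize :
    Fintype.card (G.Idx G.output) * ∏ a, G.colSize σ a = Fintype.card G.Assignment := by
  simp only [colSize, card_idx]
  rw [← Finset.prod_biUnion fun a _ b _ hab => G.disjoint_colEdges σ hab, biUnion_colEdges,
    Finset.prod_mul_prod_compl, Fintype.card_pi]
  simp

end Edges

/-! ### Counting assignments -/

section Glue

variable (G : EmbeddingNetwork V E)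

theorem glue_of_mem {F : Finset E} {e : E} (h : e ∈ F) (c : G.Idx F) (x : G.Assignment) :
    G.glue F c x e = c ⟨e, h⟩ := dif_pos h

theorem glue_of_notMem {F : Finset E} {e : E} (h : e ∉ F) (c : G.Idx F) (x : G.Assignment) :
    G.glue F c x e = x e := dif_neg h

/-- Exchanging the values on `F` between `c` and `x` is an involution on pairs, and it turns `glue F
c x` into the second component. -/
theorem sum_sum_glue (F : Finset E) (h : G.Assignment → ℝ) :
    ∑ c : G.Idx F, ∑ x : G.Assignment, h (G.glue F c x)
      = Fintype.card (G.Idx F) * ∑ x, h x := by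
  have h1 : ∑ p : G.Idx F × G.Assignment, h (G.glue F p.1 p.2)
      = ∑ p : G.Idx F × G.Assignment, h p.2 := by
    have hinv : ∀ p : G.Idx F × G.Assignment, ((fun e : F => (G.glue F p.1 p.2) e),
        G.glue F (fun e : F => p.2 e) (G.glue F p.1 p.2)) = p := by
      rintro ⟨c, x⟩
      ext e
      · simp [glue_of_mem]
      · by_cases he : e ∈ F
        · simp [glue_of_mem, he]
        · simp [glue_of_notMem, he]
    refine Finset.sum_nbij' (fun p => ((fun e : F => p.2 e), G.glue F p.1 p.2))
      (fun p => ((fun e : F => p.2 e), G.glue F p.1 p.2)) (by simp) (by simp)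
      (fun p _ => hinv p) (fun p _ => hinv p) (by simp)
  rw [Fintype.sum_prod_type, Fintype.sum_prod_type] at h1
  rw [h1]
  simp

theorem sum_restrict (F : Finset E) (h : G.Idx F → ℝ) :
    Fintype.card (G.Idx F) * ∑ x : G.Assignment, h (fun e => x e)
      = Fintype.card G.Assignment * ∑ c, h c := by
  rw [← G.sum_sum_glue F fun x => h fun e => x e, Finset.mul_sum]
  refine Finset.sum_congr rfl fun c _ => ?_
  have : ∀ x : G.Assignment, (fun e : F => G.glue F c x e) = c := by
    intro x; ext e; simp [glue_of_mem]
  simp [this]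

end Glue

/-! ### The embedding as a sequence of matrix products -/

section Sketch

variable (G : EmbeddingNetwork V E) (σ : G.Linearization)

/-- The multiplication by the matricized tensor at the vertex `a`: contraction of the tensor `t`
at `a` with `f` along the column dimensions of `a`. -/
def contract (a : V) (t : G.Core a) (f : G.Assignment → ℝ) : G.Assignment → ℝ := fun x =>
  ∑ c : G.Idx (G.colEdges σ a),
    t (fun e => G.glue _ c x e) * f (G.glue _ c x)

/-- The vector `u` multiplied by the tensors at the vertices in the list `l`, the last one
first. -/
def partialSketch (u : G.Idx G.input → ℝ) (T : (a : V) → G.Core a) :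
    List V → G.Assignment → ℝ
  | [] => fun x => u fun e => x e
  | a :: l => G.contract σ a (T a) (partialSketch u T l)

theorem partialSketch_congr_core (u : G.Idx G.input → ℝ) {T T' : (a : V) → G.Core a}
    {l : List V} (h : ∀ a ∈ l, T a = T' a) :
    G.partialSketch σ u T l = G.partialSketch σ u T' l := by
  induction l with
  | nil => rfl
  | cons a l ih =>
    simp only [partialSketch]
    rw [h a (by simp), ih fun b hb => h b (by simp [hb])]

/-- The row edges of `a` are neither input edges nor incident to a lower vertex, so they do not
occur before `a` is absorbed. -/
theorem partialSketch_congr (u : G.Idx G.input → ℝ) (T : (a : V) → G.Core a) {l : List V}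
    {a : V} (hl : ∀ b ∈ l, σ b < σ a) {x y : G.Assignment}
    (hxy : ∀ e, e ∉ G.rowEdges σ a → x e = y e) :
    G.partialSketch σ u T l x = G.partialSketch σ u T l y := by
  induction l generalizing x y with
  | nil =>
    simp only [partialSketch]
    congr 1
    ext e
    rw [hxy e fun h => G.notMem_input_of_mem_rowEdges σ h e.2]
  | cons b l ih =>
    simp only [partialSketch, contract]
    refine Finset.sum_congr rfl fun c _ => ?_
    have hg : ∀ e, e ∉ G.rowEdges σ a → G.glue _ c x e = G.glue _ c y e := by
      intro e he
      by_cases hc : e ∈ G.colEdges σ b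
      · rw [glue_of_mem _ hc, glue_of_mem _ hc]
      · rw [glue_of_notMem _ hc, glue_of_notMem _ hc, hxy e he]
    rw [ih (fun b hb => hl b (by simp [hb])) hg]
    congr 2
    ext e
    rw [hg e fun h => G.notMem_incident_of_mem_rowEdges σ (hl b (by simp)) h e.2]

/-- The column edges of the vertices in `l` have been summed over; all other edges stay pinned to
`x`. -/
theorem partialSketch_eq_sum (u : G.Idx G.input → ℝ) (T : (a : V) → G.Core a) {l : List V}
    (hl : l.Pairwise fun a b => σ b < σ a) (x : G.Assignment) :
    G.partialSketch σ u T l x = ∑ y : G.Assignment,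
      if ∀ e, (∀ b ∈ l, e ∉ G.colEdges σ b) → y e = x e then
        (l.map fun a => T a fun e => y e).prod * u (fun e => y e) else 0 := by
  induction l generalizing x with
  | nil =>
    simp only [partialSketch, List.not_mem_nil, false_imp_iff, implies_true, true_imp_iff,
      List.map_nil, List.prod_nil, one_mul]
    rw [Finset.sum_eq_single x]
    · simp
    · intro y _ hy
      exact if_neg fun h => hy (funext h)
    · simp
  | cons a l ih =>
    rw [List.pairwise_cons] at hl
    simp only [partialSketch, contract]
    simp_rw [ih hl.2, Finset.mul_sum]
    rw [Finset.sum_comm]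
    refine Finset.sum_congr rfl fun y _ => ?_
    have hT : ∀ c : G.Idx (G.colEdges σ a),
        (∀ e, (∀ b ∈ l, e ∉ G.colEdges σ b) → y e = G.glue _ c x e) →
        (fun e : G.incident a => G.glue _ c x e) = fun e : G.incident a => y e := by
      intro c hc
      ext e
      rw [hc e fun b hb he => G.notMem_incident_of_mem_colEdges σ (hl.1 b hb) he e.2]
    -- The column edges of `a` are not column edges of lower vertices, so the condition on `y` pins
    -- them to `c`: only one `c` contributes.
    rw [Finset.sum_eq_single (fun e : G.colEdges σ a => y e)]
    · have hiff : (∀ e, (∀ b ∈ l, e ∉ G.colEdges σ b) →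
          y e = G.glue _ (fun e : G.colEdges σ a => y e) x e) ↔
          ∀ e, (∀ b ∈ a :: l, e ∉ G.colEdges σ b) → y e = x e := by
        refine forall_congr' fun e => ?_
        by_cases he : e ∈ G.colEdges σ a
        · simp [glue_of_mem, he]
        · simp [glue_of_notMem, he]
      by_cases h : ∀ e, (∀ b ∈ l, e ∉ G.colEdges σ b) →
          y e = G.glue _ (fun e : G.colEdges σ a => y e) x e
      · rw [if_pos h, if_pos (hiff.mp h), hT _ h, List.map_cons, List.prod_cons, mul_assoc]
      · rw [if_neg h, if_neg fun h' => h (hiff.mpr h'), mul_zero]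
    · intro c _ hc
      rw [if_neg, mul_zero]
      intro h
      refine hc (funext fun e => ?_)
      have h1 := h e fun b hb he =>
        G.notMem_incident_of_mem_colEdges σ (hl.1 b hb) he (Finset.sdiff_subset e.2)
      rw [glue_of_mem _ e.2] at h1
      exact h1.symm
    · simp

theorem partialSketch_univ (u : G.Idx G.input → ℝ) (T : (a : V) → G.Core a) {l : List V}
    (hl : l.Pairwise fun a b => σ b < σ a) (hmem : ∀ a, a ∈ l) (x : G.Assignment) :
    G.partialSketch σ u T l x = (G.embedding T *ᵥ u) fun e => x e := by
  rw [partialSketch_eq_sum _ _ _ _ hl, Matrix.mulVec, dotProduct]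
  simp only [embedding, Matrix.of_apply, Finset.sum_mul]
  rw [Finset.sum_comm]
  refine Finset.sum_congr rfl fun y _ => ?_
  have hnd : l.Nodup := hl.imp fun {a b} h => by rintro rfl; exact h.false
  have huniv : l.toFinset = Finset.univ := by ext a; simp [hmem]
  have hprod : (l.map fun a => T a fun e => y e).prod = ∏ a, T a fun e => y e := by
    rw [← huniv, List.prod_toFinset _ hnd]
  have hiff : (∀ e, (∀ b ∈ l, e ∉ G.colEdges σ b) → y e = x e) ↔
      ∀ e : G.output, y e = x e := by
    constructor
    · intro h e
      exact h e fun b _ he => ((G.mem_colEdges σ).mp he).2.1 e.2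
    · intro h e he
      refine h ⟨e, ?_⟩
      by_contra ho
      obtain ⟨a, ha⟩ := G.exists_mem_colEdges σ ho
      exact he a (hmem a) ha
  rw [Finset.sum_eq_single (fun e : G.input => y e)]
  · simp only [hiff, implies_true, and_true, hprod, ite_mul, zero_mul]
  · intro c _ hc
    rw [if_neg, zero_mul]
    rintro ⟨_, h⟩
    exact hc (funext fun e => (h e).symm)
  · simp

/-- The squared Euclidean norm over all assignments. -/
def normSq (f : G.Assignment → ℝ) : ℝ := ∑ x, f x ^ 2

theorem contract_apply (a : V) (t : G.Core a) (f : G.Assignment → ℝ) (x : G.Assignment) :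
    G.contract σ a t f x = ∑ c, G.coreMatrix σ a t (fun e => x e) c * f (G.glue _ c x) := by
  refine Finset.sum_congr rfl fun c _ => ?_
  congr 1
  simp only [coreMatrix, Matrix.of_apply]
  congr 1
  ext e
  by_cases h : (e : E) ∈ G.rowEdges σ a
  · rw [dif_pos h, glue_of_notMem]
    exact fun hc => (Finset.mem_sdiff.mp hc).2 h
  · rw [dif_neg h]
    have hc : (e : E) ∈ G.colEdges σ a := Finset.mem_sdiff.mpr ⟨e.2, h⟩
    exact congrArg Fin.val (G.glue_of_mem hc c x)

/-- Each assignment is counted `rowSize` times by gluing `r` into `x`. As `f` ignores the row edges,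
`r` enters only through the matrix, and the right side is the squared Frobenius norm of a matrix
product with column index `x`. -/
theorem rowSize_mul_normSq_contract (a : V) (t : G.Core a) {f : G.Assignment → ℝ}
    (hf : ∀ x y, (∀ e, e ∉ G.rowEdges σ a → x e = y e) → f x = f y) :
    G.rowSize σ a * G.normSq (G.contract σ a t f)
      = ∑ r, ∑ x, (∑ c, G.coreMatrix σ a t r c * f (G.glue _ c x)) ^ 2 := by
  rw [normSq, rowSize, ← sum_sum_glue]
  refine Finset.sum_congr rfl fun r _ => Finset.sum_congr rfl fun x _ => ?_
  rw [contract_apply]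
  congr 1
  refine Finset.sum_congr rfl fun c _ => ?_
  congr 1
  · congr 1
    ext e
    simp [glue_of_mem]
  · refine hf _ _ fun e he => ?_
    by_cases hc : e ∈ G.colEdges σ a
    · rw [glue_of_mem _ hc, glue_of_mem _ hc]
    · rw [glue_of_notMem _ hc, glue_of_notMem _ hc, glue_of_notMem _ he]

theorem colSize_mul_normSq (a : V) (f : G.Assignment → ℝ) :
    G.colSize σ a * G.normSq f
      = ∑ c : G.Idx (G.colEdges σ a), ∑ x, f (G.glue _ c x) ^ 2 :=
  (G.sum_sum_glue _ fun x => f x ^ 2).symm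

end Sketch

end EmbeddingNetwork

/-! ### Conditioning, and concentration from moments -/

/-- By independence the joint law is a product, so Tonelli allows `X` to be frozen at `s`. -/
theorem lintegral_le_of_indepFun {Ω α β : Type*} [MeasurableSpace Ω] [MeasurableSpace α]
    [MeasurableSpace β] {P : Measure Ω} [IsProbabilityMeasure P] {X : Ω → α} {Y : Ω → β}
    (hX : AEMeasurable X P) (hY : AEMeasurable Y P) (hXY : IndepFun X Y P)
    {Φ : α → β → ENNReal} (hΦ : Measurable (Function.uncurry Φ)) {Ψ : α → ENNReal}
    (hΨ : Measurable Ψ) (h : ∀ s, ∫⁻ ω, Φ s (Y ω) ∂P ≤ Ψ s) :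
    ∫⁻ ω, Φ (X ω) (Y ω) ∂P ≤ ∫⁻ ω, Ψ (X ω) ∂P := by
  calc ∫⁻ ω, Φ (X ω) (Y ω) ∂P
      = ∫⁻ p, Function.uncurry Φ p ∂(P.map fun ω => (X ω, Y ω)) := by
        rw [lintegral_map' hΦ.aemeasurable (hX.prodMk hY)]
        rfl
    _ = ∫⁻ s, ∫⁻ t, Φ s t ∂(P.map Y) ∂(P.map X) := by
        rw [hXY.map_prod_eq_prod_map_map hX hY, lintegral_prod _ hΦ.aemeasurable]
        rfl
    _ ≤ ∫⁻ s, Ψ s ∂(P.map X) := by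
        refine lintegral_mono fun s => ?_
        have hs : Measurable (Φ s) := hΦ.comp measurable_prodMk_left
        rw [lintegral_map' hs.aemeasurable hY]
        exact h s
    _ = ∫⁻ ω, Ψ (X ω) ∂P := lintegral_map' hΨ.aemeasurable hX

theorem measureReal_le_exp_of_moment {Ω : Type*} [MeasurableSpace Ω] {P : Measure Ω}
    {Y : Ω → ℝ} (hY : AEMeasurable Y P) {p v w : ℝ} {s : Set Ω}
    (hmom : ∫⁻ ω, ENNReal.ofReal (Y ω) ^ p ∂P ≤ ENNReal.ofReal (Real.exp v))
    (hs : ∀ ω ∈ s, ENNReal.ofReal (Real.exp w) ≤ ENNReal.ofReal (Y ω) ^ p) :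
    P.real s ≤ Real.exp (v - w) := by
  refine ENNReal.toReal_le_of_le_ofReal (Real.exp_nonneg _) ?_
  have h1 := mul_meas_ge_le_lintegral₀ (μ := P) (hY.ennreal_ofReal.pow_const p)
    (ENNReal.ofReal (Real.exp w))
  have h2 : ENNReal.ofReal (Real.exp w) * P s ≤ ENNReal.ofReal (Real.exp v) :=
    (mul_le_mul_right (measure_mono hs) _).trans (h1.trans hmom)
  rw [Real.exp_sub, ENNReal.ofReal_div_of_pos (Real.exp_pos _)]
  rw [ENNReal.le_div_iff_mul_le (by simp [Real.exp_pos]) (by simp), mul_comm]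
  exact h2

/-- Concentration around one of a nonnegative random variable with controlled integer
moments of both signs. -/
theorem measureReal_abs_sub_one_lt {Ω : Type*} [MeasurableSpace Ω] {P : Measure Ω}
    [IsProbabilityMeasure P] {Y : Ω → ℝ} (hY : AEMeasurable Y P) (hY0 : ∀ ω, 0 ≤ Y ω)
    {B ε δ : ℝ} (hε : 0 < ε) (hε1 : ε ≤ 1) (hB : 64 ≤ B * ε)
    (hδ : 2 * Real.exp (-(B * ε ^ 2 / 128)) < δ)
    (hmom : ∀ z : ℤ, z ≠ 0 → |(z : ℝ)| ≤ B / 4 →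
      ∫⁻ ω, ENNReal.ofReal (Y ω) ^ (z : ℝ) ∂P ≤ ENNReal.ofReal (Real.exp (4 * z ^ 2 / B))) :
    P.real {ω | ε < |Y ω - 1|} < δ := by
  have hB0 : 0 < B := pos_of_mul_pos_left (by linarith) hε.le
  -- The exponent `4 q² / B - q ε / 2` is minimal at `q = B ε / 16`. The interval chosen below this
  -- point has length `B ε / 64 ≥ 1`, so it contains an integer.
  obtain ⟨q, hq1, hq2⟩ : ∃ q : ℕ, B * ε / 32 ≤ q ∧ (q : ℝ) ≤ 3 * (B * ε) / 64 :=
    ⟨⌈B * ε / 32⌉₊, Nat.le_ceil _,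
      (Nat.ceil_lt_add_one (by positivity)).le.trans (by linarith)⟩
  have hqpos : (0 : ℝ) < q := by linarith
  have hq0 : q ≠ 0 := by rintro rfl; simp at hqpos
  have hqB : (q : ℝ) ≤ B / 4 := by nlinarith
  have hexp : 4 * (q : ℝ) ^ 2 / B - q * ε / 2 ≤ -(B * ε ^ 2 / 128) := by
    have h1 : 4 * (q : ℝ) ^ 2 / B ≤ q * ε * (3 / 16) := by
      rw [div_le_iff₀ hB0]
      nlinarith
    nlinarith
  have hup : P.real {ω | Real.exp (ε / 2) ≤ Y ω} ≤ Real.exp (-(B * ε ^ 2 / 128)) := by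
    have h := hmom q (by exact_mod_cast hq0) (by simpa using hqB)
    push_cast at h
    refine (measureReal_le_exp_of_moment (w := q * ε / 2) hY h fun ω hω => ?_).trans
      (Real.exp_le_exp.mpr hexp)
    have hω' : Real.exp (ε / 2) ≤ Y ω := hω
    rw [ENNReal.rpow_natCast, ← ENNReal.ofReal_pow (hY0 ω)]
    refine ENNReal.ofReal_le_ofReal ?_
    calc Real.exp (q * ε / 2) = Real.exp (ε / 2) ^ q := by
          rw [← Real.exp_nat_mul]; ring_nf
      _ ≤ _ := by gcongr
  have hlow : P.real {ω | Y ω ≤ Real.exp (-(ε / 2))} ≤ Real.exp (-(B * ε ^ 2 / 128)) := by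
    have h := hmom (-q) (by simpa using hq0) (by simpa using hqB)
    push_cast at h
    rw [neg_sq] at h
    refine (measureReal_le_exp_of_moment (w := q * ε / 2) hY h fun ω hω => ?_).trans
      (Real.exp_le_exp.mpr hexp)
    have hω' : Y ω ≤ Real.exp (-(ε / 2)) := hω
    -- The value `Y ω = 0` is included: its negative power is `⊤`.
    rw [ENNReal.rpow_neg, ENNReal.rpow_natCast, ← ENNReal.ofReal_pow (hY0 ω),
      ENNReal.le_inv_iff_mul_le, ← ENNReal.ofReal_mul (Real.exp_nonneg _)]
    refine ENNReal.ofReal_le_one.mpr ?_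
    calc Real.exp (q * ε / 2) * Y ω ^ q
        ≤ Real.exp (q * ε / 2) * Real.exp (-(ε / 2)) ^ q := by
          gcongr
          exact hY0 ω
      _ = 1 := by
          rw [← Real.exp_nat_mul, ← Real.exp_add, Real.exp_eq_one_iff]
          ring
  have hsub : {ω | ε < |Y ω - 1|} ⊆
      {ω | Real.exp (ε / 2) ≤ Y ω} ∪ {ω | Y ω ≤ Real.exp (-(ε / 2))} := by
    -- For `ε ≤ 1`, `exp (ε/2) ≤ 1 + ε/2 + ε²/4 ≤ 1 + ε` and `1 - ε ≤ exp (-ε/2)`.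
    intro ω hω
    rcases lt_abs.mp (show ε < |Y ω - 1| from hω) with h | h
    · left
      have h1 : |Real.exp (ε / 2) - 1 - ε / 2| ≤ (ε / 2) ^ 2 :=
        Real.abs_exp_sub_one_sub_id_le (by rw [abs_of_pos (by positivity)]; linarith)
      have h2 := (abs_le.mp h1).2
      show Real.exp (ε / 2) ≤ Y ω
      nlinarith
    · right
      have h1 := Real.add_one_le_exp (-(ε / 2))
      show Y ω ≤ Real.exp (-(ε / 2))
      linarith
  calc P.real {ω | ε < |Y ω - 1|} ≤ _ := measureReal_mono hsub
    _ ≤ _ := measureReal_union_le _ _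
    _ ≤ 2 * Real.exp (-(B * ε ^ 2 / 128)) := by linarith
    _ < δ := hδ

/-! ### Moments of the sketched norm -/

namespace EmbeddingNetwork

variable {V : Type u} {E : Type v} [Fintype V] [DecidableEq V] [Fintype E] [DecidableEq E]
  {Ω : Type w} [MeasurableSpace Ω] {P : Measure Ω} (G : EmbeddingNetwork V E)
  (σ : G.Linearization)

/-- Every entry of the tensor is an entry of its matricization, hence a multiple of a variable with
a law. -/
theorem aemeasurable_of_coreMatrix {a : V} {A : Ω → G.Core a}
    (h : IsGaussianEmbedding P fun ω => G.coreMatrix σ a (A ω)) : AEMeasurable A P := by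
  obtain ⟨M, hM, -, hA⟩ := h
  refine aemeasurable_pi_lambda _ fun f => ?_
  let r : G.Idx (G.rowEdges σ a) := fun e => f ⟨e, Finset.filter_subset _ _ e.2⟩
  let c : G.Idx (G.colEdges σ a) := fun e => f ⟨e, Finset.sdiff_subset e.2⟩
  have h1 : (fun ω => A ω f) = fun ω => 1 / √(Fintype.card (G.Idx (G.rowEdges σ a)) : ℝ)
      * M (r, c) ω := by
    ext ω
    rw [← hA ω r c]
    simp only [coreMatrix, Matrix.of_apply]
    congr 1
    ext e
    split_ifs <;> rfl
  rw [h1]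
  exact (hM _).aemeasurable.const_mul _

theorem measurable_partialSketch (u : G.Idx G.input → ℝ) (l : List V) (x : G.Assignment) :
    Measurable fun T : (a : V) → G.Core a => G.partialSketch σ u T l x := by
  induction l generalizing x with
  | nil => exact measurable_const
  | cons a l ih =>
    simp only [partialSketch, contract]
    refine Finset.measurable_sum _ fun c _ => Measurable.mul ?_ (ih _)
    exact (measurable_pi_apply _).comp (measurable_pi_apply a)

/-- The expected growth of a moment of the squared norm in one contraction step. -/
theorem lintegral_normSq_contract_le {a : V} {A : Ω → G.Core a}
    (h : IsGaussianEmbedding P fun ω => G.coreMatrix σ a (A ω)) {z : ℤ} (hz0 : z ≠ 0)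
    (hz : |(z : ℝ)| ≤ G.rowSize σ a / 4) {f : G.Assignment → ℝ}
    (hf : ∀ x y, (∀ e, e ∉ G.rowEdges σ a → x e = y e) → f x = f y) :
    ∫⁻ ω, ENNReal.ofReal ((G.rowSize σ a / G.colSize σ a : ℝ)
        * G.normSq (G.contract σ a (A ω) f)) ^ (z : ℝ) ∂P
      ≤ ENNReal.ofReal (Real.exp (4 * z ^ 2 / G.rowSize σ a))
        * ENNReal.ofReal (G.normSq f) ^ (z : ℝ) := by
  have hc : (0 : ℝ) < G.colSize σ a := by exact_mod_cast G.colSize_pos σ a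
  have hc' : √(G.colSize σ a : ℝ) ≠ 0 := (Real.sqrt_pos.mpr hc).ne'
  -- Gluing counts every assignment `colSize` times; the root in the denominator restores `normSq
  -- f`.
  have key := h.lintegral_rpow_le hz0 hz fun c (x : G.Assignment) =>
    f (G.glue _ c x) / √(G.colSize σ a : ℝ)
  have h1 : ∀ ω, ∑ r, ∑ x : G.Assignment, (∑ c, G.coreMatrix σ a (A ω) r c
      * (f (G.glue _ c x) / √(G.colSize σ a : ℝ))) ^ 2
      = (G.rowSize σ a / G.colSize σ a : ℝ) * G.normSq (G.contract σ a (A ω) f) := by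
    intro ω
    rw [div_mul_eq_mul_div, G.rowSize_mul_normSq_contract σ a (A ω) hf, Finset.sum_div]
    refine Finset.sum_congr rfl fun r _ => ?_
    rw [Finset.sum_div]
    refine Finset.sum_congr rfl fun x _ => ?_
    simp_rw [← mul_div_assoc]
    rw [← Finset.sum_div, div_pow, Real.sq_sqrt hc.le]
  have h2 : ∑ c : G.Idx (G.colEdges σ a), ∑ x : G.Assignment,
      (f (G.glue _ c x) / √(G.colSize σ a : ℝ)) ^ 2 = G.normSq f := by
    simp_rw [div_pow, Real.sq_sqrt hc.le, ← Finset.sum_div]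
    rw [← colSize_mul_normSq, mul_div_cancel_left₀ _ hc.ne']
  simp_rw [h1, h2] at key
  exact key

theorem lintegral_normSq_partialSketch_le [IsProbabilityMeasure P]
    {A : (a : V) → Ω → G.Core a} (hA : G.IsGaussian σ P A) {z : ℤ} (hz0 : z ≠ 0)
    (hz : ∀ a, |(z : ℝ)| ≤ G.rowSize σ a / 4) (u : G.Idx G.input → ℝ) {l : List V}
    (hl : l.Pairwise fun a b => σ b < σ a) :
    ∫⁻ ω, ENNReal.ofReal ((l.map fun a => (G.rowSize σ a / G.colSize σ a : ℝ)).prod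
        * G.normSq (G.partialSketch σ u (fun a => A a ω) l)) ^ (z : ℝ) ∂P
      ≤ (l.map fun a => ENNReal.ofReal (Real.exp (4 * z ^ 2 / G.rowSize σ a))).prod
        * ENNReal.ofReal (∑ x : G.Assignment, u (fun e => x e) ^ 2) ^ (z : ℝ) := by
  have hmeas : ∀ a, AEMeasurable (A a) P := fun a => G.aemeasurable_of_coreMatrix σ (hA.2 a)
  induction l with
  | nil => simp [partialSketch, normSq]
  | cons a l ih =>
    rw [List.pairwise_cons] at hl
    specialize ih hl.2
    set ρ := (l.map fun a => (G.rowSize σ a / G.colSize σ a : ℝ)).prod with hρ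
    have hρ0 : 0 ≤ ρ := List.prod_nonneg fun x hx => by
      obtain ⟨b, -, rfl⟩ := List.mem_map.mp hx
      positivity
    have hanotin : a ∉ l := fun h => (hl.1 a h).false
    -- Padding with zero tensors makes the partial sketch a function of the tensors in `l` alone,
    -- which are independent of `A a`.
    let ext : ((b : l.toFinset) → G.Core b) → (b : V) → G.Core b := fun s b =>
      if h : b ∈ l.toFinset then s ⟨b, h⟩ else 0
    have hext : Measurable ext := by
      refine measurable_pi_lambda _ fun b => ?_
      by_cases h : b ∈ l.toFinset
      · simp only [ext, h, dif_pos]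
        exact measurable_pi_apply _
      · simp only [ext, h, dif_neg, not_false_iff]
        exact measurable_const
    let F : ((b : l.toFinset) → G.Core b) → G.Assignment → ℝ := fun s =>
      G.partialSketch σ u (ext s) l
    have hF : ∀ x, Measurable fun s => F s x := fun x =>
      (G.measurable_partialSketch σ u l x).comp hext
    have hFA : ∀ ω, F (fun b => A b ω) = G.partialSketch σ u (fun a => A a ω) l := fun ω =>
      G.partialSketch_congr_core σ u fun b hb => by simp [ext, hb]
    have hnorm : Measurable fun s => G.normSq (F s) :=
      Finset.measurable_sum _ fun x _ => (hF x).pow_const 2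
    set K := ENNReal.ofReal (Real.exp (4 * z ^ 2 / G.rowSize σ a)) with hK
    let Φ : ((b : l.toFinset) → G.Core b) → G.Core a → ENNReal := fun s t =>
      ENNReal.ofReal ((G.rowSize σ a / G.colSize σ a : ℝ) * ρ
        * G.normSq (G.contract σ a t (F s))) ^ (z : ℝ)
    let Ψ : ((b : l.toFinset) → G.Core b) → ENNReal := fun s =>
      K * ENNReal.ofReal (ρ * G.normSq (F s)) ^ (z : ℝ)
    have hΦ : Measurable (Function.uncurry Φ) := by
      refine Measurable.pow_const (ENNReal.measurable_ofReal.comp (Measurable.const_mul ?_ _)) _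
      refine Finset.measurable_sum _ fun x _ => Measurable.pow_const ?_ 2
      refine Finset.measurable_sum _ fun c _ => Measurable.mul ?_ ((hF _).comp measurable_fst)
      exact (measurable_pi_apply _).comp measurable_snd
    have hΨ : Measurable Ψ :=
      ((ENNReal.measurable_ofReal.comp (hnorm.const_mul _)).pow_const _).const_mul _
    have hscale : ∀ y : ℝ, ENNReal.ofReal (ρ * y) ^ (z : ℝ)
        = ENNReal.ofReal ρ ^ (z : ℝ) * ENNReal.ofReal y ^ (z : ℝ) := fun y => by
      rw [ENNReal.ofReal_mul hρ0, ENNReal.mul_rpow_of_ne_top (by simp) (by simp)]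
    have hstep : ∀ s, ∫⁻ ω, Φ s (A a ω) ∂P ≤ Ψ s := by
      intro s
      have h1 := G.lintegral_normSq_contract_le σ (hA.2 a) hz0 (hz a) (f := F s)
        fun x y hxy => G.partialSketch_congr σ u _ hl.1 hxy
      have hm : AEMeasurable (fun ω => ENNReal.ofReal ((G.rowSize σ a / G.colSize σ a : ℝ)
          * G.normSq (G.contract σ a (A a ω) (F s))) ^ (z : ℝ)) P := by
        refine AEMeasurable.pow_const (AEMeasurable.ennreal_ofReal
          (AEMeasurable.const_mul ?_ _)) _
        refine Finset.aemeasurable_fun_sum _ fun x _ => AEMeasurable.pow_const ?_ 2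
        refine Finset.aemeasurable_fun_sum _ fun c _ => AEMeasurable.mul_const ?_ _
        exact (measurable_pi_apply _).comp_aemeasurable (hmeas a)
      simp only [Φ, Ψ]
      simp_rw [mul_comm _ ρ, mul_assoc, hscale]
      rw [lintegral_const_mul'' _ hm, mul_left_comm]
      gcongr
    have hind : IndepFun (fun ω (b : l.toFinset) => A b ω) (A a) P := by
      have h1 := hA.1.indepFun_finset₀ l.toFinset {a} (by simpa using hanotin) hmeas
      have hψ : Measurable fun s : (b : ({a} : Finset V)) → G.Core b =>
          s ⟨a, Finset.mem_singleton_self a⟩ := measurable_pi_apply _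
      exact h1.comp measurable_id hψ
    have hmain := lintegral_le_of_indepFun
      (X := fun ω (b : l.toFinset) => A b ω) (aemeasurable_pi_lambda _ fun b => hmeas b) (hmeas a)
      hind hΦ hΨ hstep
    simp only [Φ, Ψ, hFA] at hmain
    rw [lintegral_const_mul' _ _ (by simp [hK])] at hmain
    simp only [List.map_cons, List.prod_cons, partialSketch]
    refine hmain.trans ?_
    rw [mul_assoc]
    gcongr

/-- Moment bound for the squared norm of the sketch of a unit vector. -/
theorem lintegral_normSq_embedding_le [IsProbabilityMeasure P]
    {A : (a : V) → Ω → G.Core a} (hA : G.IsGaussian σ P A) {z : ℤ} (hz0 : z ≠ 0)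
    (hz : ∀ a, |(z : ℝ)| ≤ G.rowSize σ a / 4) {u : G.Idx G.input → ℝ}
    (hu : ∑ c, u c ^ 2 = 1) :
    ∫⁻ ω, ENNReal.ofReal (∑ r, (G.embedding (fun a => A a ω) *ᵥ u) r ^ 2) ^ (z : ℝ) ∂P
      ≤ ENNReal.ofReal (Real.exp (∑ a, 4 * z ^ 2 / G.rowSize σ a)) := by
  -- The order is descending because `partialSketch` absorbs the last list entry first.
  let l : List V := (List.finRange (Fintype.card V)).reverse.map σ.symm
  have hl : l.Pairwise fun a b => σ b < σ a := by
    rw [List.pairwise_map, List.pairwise_reverse]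
    simpa using List.pairwise_lt_finRange _
  have hmem : ∀ a, a ∈ l := fun a => by
    simp only [l, List.mem_map, List.mem_reverse]
    exact ⟨σ a, List.mem_finRange _, by simp⟩
  have hnd : l.Nodup := hl.imp fun {a b} h => by rintro rfl; exact h.false
  have huniv : l.toFinset = Finset.univ := by ext a; simp [hmem]
  have key := G.lintegral_normSq_partialSketch_le σ hA hz0 hz u hl
  rw [← List.prod_toFinset _ hnd, ← List.prod_toFinset _ hnd, huniv, Finset.prod_div_distrib,
    ← ENNReal.ofReal_prod_of_nonneg fun a _ => (Real.exp_nonneg _), ← Real.exp_sum] at key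
  -- The number of assignments extending a given input index. It multiplies both squared norms,
  -- hence cancels.
  set κ : ℝ := Fintype.card G.Assignment / Fintype.card (G.Idx G.input) with hκ
  have hin : (0 : ℝ) < Fintype.card (G.Idx G.input) := by exact_mod_cast G.card_idx_pos _
  have hout : (0 : ℝ) < Fintype.card (G.Idx G.output) := by exact_mod_cast G.card_idx_pos _
  have hrow : (Fintype.card (G.Idx G.input) : ℝ) * ∏ a, (G.rowSize σ a : ℝ)
      = Fintype.card G.Assignment := by exact_mod_cast G.card_input_mul_prod_rowSize σ
  have hcol : (Fintype.card (G.Idx G.output) : ℝ) * ∏ a, (G.colSize σ a : ℝ)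
      = Fintype.card G.Assignment := by exact_mod_cast G.card_output_mul_prod_colSize σ
  have hcolpos : 0 < ∏ a, (G.colSize σ a : ℝ) :=
    Finset.prod_pos fun a _ => by exact_mod_cast G.colSize_pos σ a
  have hall : (0 : ℝ) < Fintype.card G.Assignment := (mul_pos hout hcolpos).trans_eq hcol
  have hκ0 : 0 < κ := div_pos hall hin
  have h1 : ∑ x : G.Assignment, u (fun e => x e) ^ 2 = κ := by
    have := G.sum_restrict G.input fun c => u c ^ 2
    rw [hu, mul_one] at this
    rw [hκ, eq_div_iff hin.ne', mul_comm]
    exact this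
  have h2 : ∀ ω, (∏ a, (G.rowSize σ a : ℝ)) / (∏ a, (G.colSize σ a : ℝ))
      * G.normSq (G.partialSketch σ u (fun a => A a ω) l)
      = κ * ∑ r, (G.embedding (fun a => A a ω) *ᵥ u) r ^ 2 := by
    intro ω
    have h3 : G.normSq (G.partialSketch σ u (fun a => A a ω) l)
        = Fintype.card G.Assignment / Fintype.card (G.Idx G.output)
          * ∑ r, (G.embedding (fun a => A a ω) *ᵥ u) r ^ 2 := by
      simp only [normSq, G.partialSketch_univ σ u _ hl hmem]
      rw [div_mul_eq_mul_div, eq_div_iff hout.ne', mul_comm]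
      exact G.sum_restrict G.output fun r => (G.embedding (fun a => A a ω) *ᵥ u) r ^ 2
    rw [h3, ← mul_assoc]
    congr 1
    rw [hκ]
    field_simp
    rw [mul_comm, hrow, ← hcol, mul_comm]
  simp_rw [h1, h2, ENNReal.ofReal_mul hκ0.le] at key
  have hκz : ENNReal.ofReal κ ^ (z : ℝ) ≠ 0 ∧ ENNReal.ofReal κ ^ (z : ℝ) ≠ ⊤ := by
    rw [ENNReal.ofReal_rpow_of_pos hκ0]
    exact ⟨by simpa using zpow_pos hκ0 z, ENNReal.ofReal_ne_top⟩
  simp_rw [ENNReal.mul_rpow_of_ne_top ENNReal.ofReal_ne_top ENNReal.ofReal_ne_top] at key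
  rw [lintegral_const_mul' _ _ hκz.2, mul_comm] at key
  exact (ENNReal.mul_le_mul_iff_left hκz.1 hκz.2).mp key

theorem aemeasurable_normSq_embedding {A : (a : V) → Ω → G.Core a}
    (hA : ∀ a, AEMeasurable (A a) P) (u : G.Idx G.input → ℝ) :
    AEMeasurable (fun ω => ∑ r, (G.embedding (fun a => A a ω) *ᵥ u) r ^ 2) P := by
  have h : ∀ a f, AEMeasurable (fun ω => A a ω f) P := fun a f =>
    (measurable_pi_apply f).comp_aemeasurable (hA a)
  refine Finset.aemeasurable_fun_sum _ fun r _ => AEMeasurable.pow_const ?_ 2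
  refine Finset.aemeasurable_fun_sum _ fun c _ => AEMeasurable.mul_const ?_ _
  refine Finset.aemeasurable_fun_sum _ fun x _ => ?_
  split_ifs
  · exact Finset.aemeasurable_fun_prod _ fun a _ => h a _
  · exact aemeasurable_const

end EmbeddingNetwork

/-! ### Choice of the constant -/

theorem theorem3p1 (δ₀ : ℝ) (hδ₀ : δ₀ < 1) :
    ∃ C : ℝ, 0 < C ∧
      ∀ (V : Type u) (E : Type v) (Ω : Type w) [Fintype V] [DecidableEq V] [Fintype E]
        [DecidableEq E] [MeasurableSpace Ω] (P : Measure Ω) [IsProbabilityMeasure P]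
        (G : EmbeddingNetwork V E) (A : (a : V) → Ω → G.Core a) (ε δ : ℝ),
        0 < ε → ε ≤ 1 → 0 < δ → δ ≤ δ₀ →
        (∃ σ : G.Linearization, G.IsGaussian σ P A ∧
          ∀ a : V, C * (Fintype.card V * Real.log (1 / δ) / ε ^ 2) ≤ (G.rowSize σ a : ℝ)) →
        IsAccurateEmbedding P (fun ω => G.embedding fun a => A a ω) ε δ := by
  rcases le_or_gt δ₀ 0 with h0 | h0
  · exact ⟨1, one_pos, fun V E Ω _ _ _ _ _ P _ G A ε δ _ _ hδ hδδ₀ => by linarith⟩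
  have hL₀ : 0 < Real.log (1 / δ₀) := Real.log_pos ((one_lt_div h0).mpr hδ₀)
  -- This gives `C L ≥ 128 (L + 1)` for `L = log (1/δ) ≥ log (1/δ₀)`. The extra 1 turns the factor 2
  -- of the two tails into `2 / e < 1`.
  refine ⟨128 * (1 + 1 / Real.log (1 / δ₀)), by positivity, ?_⟩
  intro V E Ω _ _ _ _ _ P _ G A ε δ hε hε1 hδ hδδ₀ ⟨σ, hA, hrow⟩ x hx
  set L := Real.log (1 / δ) with hL
  have hLL₀ : Real.log (1 / δ₀) ≤ L := Real.log_le_log (by positivity) (by gcongr)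
  have hLpos : 0 < L := hL₀.trans_le hLL₀
  set C := 128 * (1 + 1 / Real.log (1 / δ₀)) with hC
  have hCL : 128 * (L + 1) ≤ C * L := by
    have : 1 ≤ L / Real.log (1 / δ₀) := (one_le_div hL₀).mpr hLL₀
    calc 128 * (L + 1) ≤ 128 * (L + L / Real.log (1 / δ₀)) := by linarith
      _ = C * L := by rw [hC]; ring
  set B := C * L / ε ^ 2 with hB
  have hBε : B * ε ^ 2 = C * L := by rw [hB]; field_simp
  have hB0 : 0 < B := by rw [hB]; positivity
  have hrowB : ∀ a, Fintype.card V * B ≤ (G.rowSize σ a : ℝ) := fun a => by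
    refine le_trans (le_of_eq ?_) (hrow a)
    rw [hB]; ring
  have hx2 : ∑ c, x.ofLp c ^ 2 = 1 := by
    rw [← EuclideanSpace.real_norm_sq_eq, hx, one_pow]
  have hnorm : ∀ ω, ‖WithLp.toLp 2 ((G.embedding fun a => A a ω) *ᵥ x.ofLp)‖ ^ 2
      = ∑ r, ((G.embedding fun a => A a ω) *ᵥ x.ofLp) r ^ 2 := fun ω =>
    EuclideanSpace.real_norm_sq_eq _
  simp_rw [hnorm]
  refine measureReal_abs_sub_one_lt (B := B)
    (G.aemeasurable_normSq_embedding (fun a => G.aemeasurable_of_coreMatrix σ (hA.2 a)) _)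
    (fun ω => Finset.sum_nonneg fun r _ => sq_nonneg _) hε hε1 ?_ ?_ ?_
  · nlinarith [mul_pos hB0 hε]
  · have h1 : 2 * Real.exp (-1) < 1 := by
      have := Real.exp_one_gt_d9
      rw [Real.exp_neg, ← div_eq_mul_inv, div_lt_one (Real.exp_pos _)]
      linarith
    have h2 : Real.exp (-L) = δ := by
      rw [hL, one_div, Real.log_inv, neg_neg, Real.exp_log hδ]
    calc 2 * Real.exp (-(B * ε ^ 2 / 128)) ≤ 2 * Real.exp (-1 + -L) := by
          gcongr
          rw [hBε]
          linarith
      _ = 2 * Real.exp (-1) * δ := by rw [Real.exp_add, h2]; ring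
      _ < δ := by nlinarith
  · intro z hz0 hz
    have hBrow : ∀ a, B ≤ (G.rowSize σ a : ℝ) := fun a => by
      have : (1 : ℝ) ≤ Fintype.card V := by
        exact_mod_cast Fintype.card_pos_iff.mpr ⟨a⟩
      nlinarith [hrowB a]
    refine (G.lintegral_normSq_embedding_le σ hA hz0 (fun a => hz.trans ?_) hx2).trans
      (ENNReal.ofReal_le_ofReal (Real.exp_le_exp.mpr ?_))
    · linarith [hBrow a]
    · rcases isEmpty_or_nonempty V with hV | hV
      · simp only [Finset.univ_eq_empty, Finset.sum_empty]
        positivity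
      · have hN : (0 : ℝ) < Fintype.card V := by exact_mod_cast Fintype.card_pos
        calc ∑ a, 4 * (z : ℝ) ^ 2 / G.rowSize σ a
            ≤ ∑ _a : V, 4 * (z : ℝ) ^ 2 / (Fintype.card V * B) := by
              gcongr with a
              exact hrowB a
          _ = 4 * z ^ 2 / B := by
              rw [Finset.sum_const, Finset.card_univ, nsmul_eq_mul]
              field_simp
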